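/- Let $G$ be a finite simple graph with vertex set $V$. For a set $S\subseteq V$ of initially colored vertices, the forcing process runs in discrete time steps: at each step, every colored vertex that has exactly one non-colored neighbor forces this neighbor to become colored (and colored vertices remain colored). The set $S$ is a forcing set (zero forcing set) of $G$ if iterating this process eventually colors every vertex of $G$, and the forcing number $F(G)$ is the minimum cardinality of a forcing set of $G$. The graph $G$ is cubic if every vertex has degree $3$, and claw-free if it has no induced subgraph isomorphic to $K_{1,3}$. If $G$ is a connected, claw-free, cubic graph of order $n = |V| \ge 10$, then \[ F(G) < \frac{1}{2}n . \] -/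

import Mathlib

namespace SimpleGraph

/-- `G` is claw-free: it has no induced subgraph isomorphic to the claw `K_{1,3}`. -/
def IsClawFree {V : Type*} (G : SimpleGraph V) : Prop :=
  ¬ (completeBipartiteGraph (Fin 1) (Fin 3)).IsIndContained G

/-- One time step of the forcing process: every colored vertex (element of `S`) with exactly one
non-colored neighbor forces that neighbor to become colored; colored vertices stay colored. -/
def forcingStep {V : Type*} (G : SimpleGraph V) (S : Set V) : Set V :=
  S ∪ {w | ∃ v ∈ S, G.neighborSet v \ S = {w}}

/-- `S` is a (zero) forcing set: iterating the forcing process from `S` colors every vertex. -/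
def IsForcingSet {V : Type*} (G : SimpleGraph V) (S : Set V) : Prop :=
  ∃ t : ℕ, (G.forcingStep)^[t] S = Set.univ

/-- The forcing number `F(G)` of a finite graph: the minimum cardinality of a forcing set. -/
noncomputable def forcingNumber {V : Type*} [Fintype V] (G : SimpleGraph V) : ℕ :=
  sInf {k | ∃ S : Finset V, G.IsForcingSet (S : Set V) ∧ S.card = k}

/-- The minimum in the definition of `F(G)` is attained. -/
theorem exists_isForcingSet_card_eq_forcingNumber {V : Type*} [Fintype V] (G : SimpleGraph V) :
    ∃ S : Finset V, G.IsForcingSet (S : Set V) ∧ S.card = G.forcingNumber :=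
  Nat.sInf_mem (s := {k | ∃ S : Finset V, G.IsForcingSet (S : Set V) ∧ S.card = k})
    ⟨_, Finset.univ, ⟨0, by simp⟩, rfl⟩

end SimpleGraph

/-! Grow a colored set by adding one vertex at a time next to a stalled set `C` and closing up. If
every vertex of `C` starts a two-edge path in `C`, claw-freeness makes the two uncolored neighbors
of a boundary vertex adjacent, so each added vertex yields at least two colored ones
(`IsStalled.ncard_add_two_le`). The excess of colored vertices over twice the chosen ones therefore
never drops, and it suffices to make it positive once.

A triangle costs 3 and closes to at least 6 vertices, so the excess starts nonnegative. By
`IsStalled.growth`, an addition gaining fewer than four vertices completes a diamond. If two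
consecutive additions both did so with zero excess, the set before the second would have at most 8
vertices, yet the triangle, the first diamond and the two colored vertices of the second give 9. -/

namespace SimpleGraph

/-! ### Stalled sets and the forcing closure. -/

variable {V : Type*} {G : SimpleGraph V}

/-- A set of colored vertices from which no further vertex is forced. -/
def IsStalled (G : SimpleGraph V) (C : Set V) : Prop :=
  ∀ v ∈ C, ∀ w, G.Adj v w → (∀ u, G.Adj v u → u ≠ w → u ∈ C) → w ∈ C

/-- The least stalled set containing `S`. -/
def forcingClosure (G : SimpleGraph V) (S : Set V) : Set V :=
  {v | ∀ C, G.IsStalled C → S ⊆ C → v ∈ C}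

/-- Every vertex of `C` is an endpoint of a path with two edges inside `C`. -/
def IsPathRich (G : SimpleGraph V) (C : Set V) : Prop :=
  ∀ v ∈ C, ∃ u ∈ C, ∃ w ∈ C, G.Adj v u ∧ G.Adj u w ∧ w ≠ v

lemma subset_forcingClosure (S : Set V) : S ⊆ G.forcingClosure S :=
  fun _ hv _ _ hS => hS hv

lemma forcingClosure_subset {S C : Set V} (hC : G.IsStalled C) (h : S ⊆ C) :
    G.forcingClosure S ⊆ C :=
  fun _ hv => hv C hC h

lemma isStalled_forcingClosure (S : Set V) : G.IsStalled (G.forcingClosure S) := by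
  intro v hv w hvw h C hC hS
  exact hC v (hv C hC hS) w hvw fun u hu huw => h u hu huw C hC hS

/-- Lets growth be measured from a closed set while the cost is counted on the chosen vertices
alone. -/
lemma forcingClosure_insert_forcingClosure (a : V) (S : Set V) :
    G.forcingClosure (insert a (G.forcingClosure S)) = G.forcingClosure (insert a S) := by
  apply subset_antisymm
  · refine forcingClosure_subset (isStalled_forcingClosure _) (Set.insert_subset ?_ ?_)
    · exact subset_forcingClosure _ (Set.mem_insert a S)
    · exact forcingClosure_subset (isStalled_forcingClosure _)
        ((Set.subset_insert a S).trans (subset_forcingClosure _))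
  · exact forcingClosure_subset (isStalled_forcingClosure _)
      ((Set.insert_subset_insert (subset_forcingClosure S)).trans (subset_forcingClosure _))

lemma isStalled_of_forcingStep_eq {C : Set V} (h : G.forcingStep C = C) : G.IsStalled C := by
  intro v hv w hvw hu
  by_contra hw
  apply hw
  rw [← h]
  refine Or.inr ⟨v, hv, ?_⟩
  ext x
  simp only [Set.mem_sdiff, mem_neighborSet, Set.mem_singleton_iff]
  constructor
  · rintro ⟨hx, hxC⟩
    by_contra hne
    exact hxC (hu x hx hne)
  · rintro rfl
    exact ⟨hvw, hw⟩

lemma isForcingSet_of_forcingClosure_eq_univ [Finite V] {S : Set V}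
    (h : G.forcingClosure S = Set.univ) : G.IsForcingSet S := by
  have hmono : Monotone fun t => (G.forcingStep)^[t] S := by
    refine monotone_nat_of_le_succ fun t => ?_
    rw [Function.iterate_succ_apply']
    exact Set.subset_union_left
  -- By finiteness the increasing iterates stabilize, and a fixed point of `forcingStep` is stalled.
  obtain ⟨t, ht⟩ := WellFoundedGT.monotone_chain_condition ⟨_, hmono⟩
  have hfix := ht (t + 1) (Nat.le_succ t)
  simp only [OrderHom.coe_mk, Function.iterate_succ_apply'] at hfix
  refine ⟨t, Set.eq_univ_of_univ_subset ?_⟩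
  rw [← h]
  exact forcingClosure_subset (isStalled_of_forcingStep_eq hfix.symm) (hmono (Nat.zero_le t))

lemma forcingNumber_le [Fintype V] {S : Finset V} (h : G.forcingClosure (S : Set V) = Set.univ) :
    G.forcingNumber ≤ S.card :=
  Nat.sInf_le ⟨S, isForcingSet_of_forcingClosure_eq_univ h, rfl⟩

lemma IsClawFree.adj_or_adj_or_adj (hclaw : G.IsClawFree) {v x y z : V} (hx : G.Adj v x)
    (hy : G.Adj v y) (hz : G.Adj v z) (hxy : x ≠ y) (hxz : x ≠ z) (hyz : y ≠ z) :
    G.Adj x y ∨ G.Adj x z ∨ G.Adj y z := by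
  by_contra! hcon
  obtain ⟨h1, h2, h3⟩ := hcon
  have h1' : ¬G.Adj y x := fun h => h1 h.symm
  have h2' : ¬G.Adj z x := fun h => h2 h.symm
  have h3' : ¬G.Adj z y := fun h => h3 h.symm
  have hinj : Function.Injective (Sum.elim (fun _ : Fin 1 => v) ![x, y, z]) := by
    have := hx.ne
    have := hy.ne
    have := hz.ne
    rintro (i | i) (j | j) h <;> fin_cases i <;> fin_cases j <;> simp_all
  have hadj : ∀ s t, G.Adj (Sum.elim (fun _ : Fin 1 => v) ![x, y, z] s)
      (Sum.elim (fun _ : Fin 1 => v) ![x, y, z] t) ↔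
      (completeBipartiteGraph (Fin 1) (Fin 3)).Adj s t := by
    rintro (i | i) (j | j) <;> fin_cases i <;> fin_cases j <;>
      simp [hx, hy, hz, hx.symm, hy.symm, hz.symm, h1, h2, h3, h1', h2', h3']
  exact hclaw ⟨⟨⟨_, hinj⟩, hadj _ _⟩⟩

lemma Connected.exists_adj_mem_notMem (hconn : G.Connected) {C : Set V} (hne : C.Nonempty)
    (hC : C ≠ Set.univ) : ∃ v ∈ C, ∃ a ∉ C, G.Adj v a := by
  obtain ⟨x, hx⟩ := hne
  obtain ⟨y, hy⟩ := (Set.ne_univ_iff_exists_notMem C).1 hC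
  obtain ⟨p⟩ := hconn.preconnected x y
  obtain ⟨d, -, h1, h2⟩ := p.exists_boundary_dart C hx hy
  exact ⟨d.fst, h1, d.snd, h2, d.adj⟩

lemma IsPathRich.insert {C : Set V} (hrich : G.IsPathRich C) {v a : V} (hv : v ∈ C)
    (ha : a ∉ C) (hva : G.Adj v a) : G.IsPathRich (insert a C) := by
  rintro x (rfl | hx)
  · obtain ⟨u, hu, -, -, hvu, -⟩ := hrich v hv
    exact ⟨v, Or.inr hv, u, Or.inr hu, hva.symm, hvu, fun h => ha (h ▸ hu)⟩
  · obtain ⟨u, hu, w, hw, h⟩ := hrich x hx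
    exact ⟨u, Or.inr hu, w, Or.inr hw, h⟩

/-! ### Cubic graphs: third neighbors and preservation of path-richness. -/

section Cubic

variable [Fintype V] [DecidableRel G.Adj]

lemma IsRegularOfDegree.exists_third (hcubic : G.IsRegularOfDegree 3) {v p q : V}
    (hp : G.Adj v p) (hq : G.Adj v q) (hpq : p ≠ q) :
    ∃ r, G.Adj v r ∧ r ≠ p ∧ r ≠ q ∧ ∀ s, G.Adj v s → s = p ∨ s = q ∨ s = r := by
  classical
  have hcard : (((G.neighborFinset v).erase p).erase q).card = 1 := by
    rw [Finset.card_erase_of_mem (by simp [hq, hpq.symm]), Finset.card_erase_of_mem (by simp [hp]),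
      card_neighborFinset_eq_degree, hcubic v]
  obtain ⟨r, hr⟩ := Finset.card_eq_one.1 hcard
  have hmem (s : V) : (s ≠ q ∧ s ≠ p ∧ G.Adj v s) ↔ s = r := by
    have := Finset.ext_iff.1 hr s
    simpa using this
  obtain ⟨h1, h2, h3⟩ := (hmem r).2 rfl
  refine ⟨r, h3, h2, h1, fun s hs => ?_⟩
  by_cases hsp : s = p
  · exact Or.inl hsp
  by_cases hsq : s = q
  · exact Or.inr (Or.inl hsq)
  exact Or.inr (Or.inr ((hmem s).1 ⟨hsq, hsp, hs⟩))

lemma IsRegularOfDegree.exists_three (hcubic : G.IsRegularOfDegree 3) (v : V) :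
    ∃ x y z, G.Adj v x ∧ G.Adj v y ∧ G.Adj v z ∧ x ≠ y ∧ x ≠ z ∧ y ≠ z := by
  classical
  have h : (G.neighborFinset v).card = 3 := by rw [card_neighborFinset_eq_degree, hcubic v]
  obtain ⟨x, y, z, hxy, hxz, hyz, h⟩ := Finset.card_eq_three.1 h
  refine ⟨x, y, z, ?_, ?_, ?_, hxy, hxz, hyz⟩ <;> rw [← mem_neighborFinset, h] <;> simp

lemma IsRegularOfDegree.eq_or_eq_or_eq (hcubic : G.IsRegularOfDegree 3) {v p q r : V}
    (hp : G.Adj v p) (hq : G.Adj v q) (hr : G.Adj v r) (hpq : p ≠ q) (hpr : p ≠ r) (hqr : q ≠ r)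
    {s : V} (hs : G.Adj v s) : s = p ∨ s = q ∨ s = r := by
  obtain ⟨t, -, -, -, h⟩ := hcubic.exists_third hp hq hpq
  have hrt : r = t := by
    rcases h r hr with h | h | h
    · exact absurd h.symm hpr
    · exact absurd h.symm hqr
    · exact h
  exact hrt ▸ h s hs

lemma IsStalled.mem_of_adj (hcubic : G.IsRegularOfDegree 3) {C : Set V} (hC : G.IsStalled C)
    {v p q : V} (hv : v ∈ C) (hp : p ∈ C) (hq : q ∈ C) (hvp : G.Adj v p) (hvq : G.Adj v q)
    (hpq : p ≠ q) {w : V} (hw : G.Adj v w) : w ∈ C := by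
  obtain ⟨r, -, -, -, hs⟩ := hcubic.exists_third hvp hvq hpq
  rcases hs w hw with rfl | rfl | rfl
  · exact hp
  · exact hq
  refine hC v hv w hw fun u hu huw => ?_
  rcases hs u hu with rfl | rfl | rfl
  · exact hp
  · exact hq
  · exact absurd rfl huw

/-- A vertex `w` forced by `v` starts a path through `v` to another neighbor of `v`, already
colored. Hence the closure vertices that start such a path form a stalled set. -/
lemma IsPathRich.forcingClosure (hcubic : G.IsRegularOfDegree 3) {S : Set V}
    (hS : G.IsPathRich S) :
    G.IsPathRich (G.forcingClosure S) := by
  suffices h : G.forcingClosure S ⊆ {v | v ∈ G.forcingClosure S ∧ ∃ u ∈ G.forcingClosure S,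
      ∃ w ∈ G.forcingClosure S, G.Adj v u ∧ G.Adj u w ∧ w ≠ v} from fun v hv => (h hv).2
  have hsub := subset_forcingClosure (G := G) S
  refine forcingClosure_subset ?_ fun v hv => ?_
  · intro v hv w hvw hu
    refine ⟨isStalled_forcingClosure S v hv.1 w hvw fun u hvu huw => (hu u hvu huw).1,
      v, hv.1, ?_⟩
    obtain ⟨x, y, z, hx, hy, -, hxy, -, -⟩ := hcubic.exists_three v
    by_cases hxw : x = w
    · exact ⟨y, (hu y hy (hxw ▸ hxy.symm)).1, hvw.symm, hy, hxw ▸ hxy.symm⟩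
    · exact ⟨x, (hu x hx hxw).1, hvw.symm, hx, hxw⟩
  · obtain ⟨u, hu, w, hw, h⟩ := hS v hv
    exact ⟨hsub hv, u, hsub hu, w, hsub hw, h⟩

/-! ### Growth of a stalled set by one added vertex. -/

/-- A colored vertex of a path-rich stalled set with a non-colored neighbor has one colored
neighbor and two adjacent non-colored ones. -/
lemma IsStalled.exists_adj_adj (hclaw : G.IsClawFree) (hcubic : G.IsRegularOfDegree 3)
    {C : Set V} (hC : G.IsStalled C) (hrich : G.IsPathRich C) {v a : V} (hv : v ∈ C)
    (ha : a ∉ C) (hva : G.Adj v a) :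
    ∃ u ∈ C, ∃ b ∉ C, G.Adj v u ∧ G.Adj v b ∧ G.Adj a b ∧
      ∀ s, G.Adj v s → s = a ∨ s = b ∨ s = u := by
  obtain ⟨b, hvb, hba, hb⟩ : ∃ b, G.Adj v b ∧ b ≠ a ∧ b ∉ C := by
    by_contra! hcon
    exact ha (hC v hv a hva hcon)
  obtain ⟨u, hu, w, hw, hvu, huw, hwv⟩ := hrich v hv
  obtain ⟨r, hvr, hra, hrb, hs⟩ := hcubic.exists_third hva hvb hba.symm
  have hur : u = r := by
    rcases hs u hvu with rfl | rfl | rfl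
    · exact absurd hu ha
    · exact absurd hu hb
    · rfl
  subst hur
  -- Having the colored neighbors `v` and `w`, `u` has no uncolored neighbor, so `a` and `b` must
  -- supply the edge that avoids a claw at `v`.
  have hall {x : V} (hx : G.Adj u x) : x ∈ C :=
    hC.mem_of_adj hcubic hu hv hw hvu.symm huw hwv.symm hx
  refine ⟨u, hu, b, hb, hvu, hvb, ?_, hs⟩
  rcases hclaw.adj_or_adj_or_adj hva hvb hvu hba.symm hra.symm hrb.symm with h | h | h
  · exact h
  · exact absurd (hall h.symm) ha
  · exact absurd (hall h.symm) hb

/-- Coloring one more vertex next to a path-rich stalled set colors at least four vertices, or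
two vertices that complete a diamond with two colored vertices. -/
lemma IsStalled.growth (hclaw : G.IsClawFree) (hcubic : G.IsRegularOfDegree 3)
    {C : Set V} (hC : G.IsStalled C) (hrich : G.IsPathRich C) {v a : V} (hv : v ∈ C)
    (ha : a ∉ C) (hva : G.Adj v a) :
    C.ncard + 4 ≤ (G.forcingClosure (insert a C)).ncard ∨
    ∃ b ∉ C, ∃ w ∈ C, a ≠ b ∧ v ≠ w ∧ G.Adj w a ∧
      insert b (insert a C) ⊆ G.forcingClosure (insert a C) ∧
      ∀ x, x = v ∨ x = w ∨ x = a ∨ x = b → ∀ y, G.Adj x y → y ∈ G.forcingClosure (insert a C) := by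
  classical
  obtain ⟨u, hu, b, hb, hvu, hvb, hab, hvs⟩ := hC.exists_adj_adj hclaw hcubic hrich hv ha hva
  set D := G.forcingClosure (insert a C) with hD
  have hDst : G.IsStalled D := isStalled_forcingClosure _
  have hCD : C ⊆ D := (Set.subset_insert a C).trans (subset_forcingClosure _)
  have haD : a ∈ D := subset_forcingClosure _ (Set.mem_insert a C)
  have hau : a ≠ u := fun h => ha (h ▸ hu)
  have hbD : b ∈ D := hDst.mem_of_adj hcubic (hCD hv) haD (hCD hu) hva hvu hau hvb
  have hvD {y : V} : G.Adj v y → y ∈ D :=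
    hDst.mem_of_adj hcubic (hCD hv) haD (hCD hu) hva hvu hau
  have haN {y : V} : G.Adj a y → y ∈ D :=
    hDst.mem_of_adj hcubic haD (hCD hv) hbD hva.symm hab hvb.ne
  have hbN {y : V} : G.Adj b y → y ∈ D :=
    hDst.mem_of_adj hcubic hbD (hCD hv) haD hvb.symm hab.symm hva.ne
  obtain ⟨a', haa', hav', hab', has⟩ := hcubic.exists_third hva.symm hab hvb.ne
  obtain ⟨b', hbb', hbv', hba', hbs⟩ := hcubic.exists_third hvb.symm hab.symm hva.ne
  have hfour (c d : V) (hc : c ∉ C) (hd : d ∉ C) (hcD : c ∈ D) (hdD : d ∈ D) (hac : a ≠ c)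
      (had : a ≠ d) (hbc : b ≠ c) (hbd : b ≠ d) (hcd : c ≠ d) : C.ncard + 4 ≤ D.ncard := by
    have hsub : insert a (insert b (insert c (insert d C))) ⊆ D := by
      simp only [Set.insert_subset_iff]
      exact ⟨haD, hbD, hcD, hdD, hCD⟩
    have := Set.ncard_le_ncard hsub (Set.toFinite _)
    rwa [Set.ncard_insert_of_notMem (by simp [*, hab.ne]), Set.ncard_insert_of_notMem (by simp [*]),
      Set.ncard_insert_of_notMem (by simp [*]), Set.ncard_insert_of_notMem hd] at this
  -- If `a'` is colored, its two uncolored neighbors are adjacent, so they are `a` and `b`, which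
  -- closes the diamond. Otherwise `b'` is uncolored too, and the four new vertices are `a`, `b`,
  -- `a'`, `b'`, or, when `a' = b'`, `a`, `b`, `a'` and the third neighbor of `a'`.
  by_cases ha'C : a' ∈ C
  · right
    obtain ⟨u2, hu2, b2, hb2, h2u, h2b, hab2, -⟩ :=
      hC.exists_adj_adj hclaw hcubic hrich ha'C ha haa'.symm
    have hb2b : b2 = b := by
      rcases has b2 hab2 with rfl | rfl | rfl
      · exact absurd hv hb2
      · rfl
      · exact absurd ha'C hb2
    subst hb2b
    refine ⟨b2, hb, a', ha'C, hab.ne, hav'.symm, haa'.symm, ?_, ?_⟩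
    · simp only [Set.insert_subset_iff]
      exact ⟨hbD, haD, hCD⟩
    · rintro x (rfl | rfl | rfl | rfl) y hy
      · exact hvD hy
      · exact hDst.mem_of_adj hcubic (hCD ha'C) haD (hCD hu2) haa'.symm h2u
          (fun h => ha (h ▸ hu2)) hy
      · exact haN hy
      · exact hbN hy
  left
  have hb'C : b' ∉ C := by
    intro hb'C
    obtain ⟨u2, hu2, b2, hb2, h2u, h2b, hbb2, -⟩ :=
      hC.exists_adj_adj hclaw hcubic hrich hb'C hb hbb'.symm
    have hb2a : b2 = a := by
      rcases hbs b2 hbb2 with rfl | rfl | rfl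
      · exact absurd hv hb2
      · rfl
      · exact absurd hb'C hb2
    subst hb2a
    rcases has b' h2b.symm with rfl | rfl | rfl
    · exact hbv' rfl
    · exact hb hb'C
    · exact ha'C hb'C
  by_cases hne : a' = b'
  · subst hne
    obtain ⟨d, had, hda, hdb, hds⟩ := hcubic.exists_third haa'.symm hbb'.symm hab.ne
    have ha'D := haN haa'
    have hdC : d ∉ C := by
      intro hdC
      obtain ⟨u2, hu2, e, he, h2u, hde, hae, -⟩ :=
        hC.exists_adj_adj hclaw hcubic hrich hdC ha'C had.symm
      rcases hds e hae with rfl | rfl | rfl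
      · rcases has d hde.symm with rfl | rfl | rfl
        · rcases hvs a' had.symm with rfl | rfl | rfl
          · exact haa'.ne rfl
          · exact hab' rfl
          · exact ha'C hu
        · exact hb hdC
        · exact ha'C hdC
      · rcases hbs d hde.symm with rfl | rfl | rfl
        · rcases hvs a' had.symm with rfl | rfl | rfl
          · exact haa'.ne rfl
          · exact hab' rfl
          · exact ha'C hu
        · exact ha hdC
        · exact ha'C hdC
      · exact he hdC
    exact hfour a' d ha'C hdC ha'D
      (hDst.mem_of_adj hcubic ha'D haD hbD haa'.symm hbb'.symm hab.ne had)
      haa'.ne hda.symm hbb'.ne hdb.symm had.ne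
  · exact hfour a' b' ha'C hb'C (haN haa') (hbN hbb') haa'.ne hba'.symm hab'.symm hbb'.ne hne

lemma IsStalled.ncard_add_two_le (hclaw : G.IsClawFree) (hcubic : G.IsRegularOfDegree 3)
    {C : Set V} (hC : G.IsStalled C) (hrich : G.IsPathRich C) {v a : V} (hv : v ∈ C)
    (ha : a ∉ C) (hva : G.Adj v a) :
    C.ncard + 2 ≤ (G.forcingClosure (insert a C)).ncard := by
  rcases hC.growth hclaw hcubic hrich hv ha hva with h | ⟨b, hb, w, hw, hab, -, -, hsub, -⟩
  · omega
  · have := Set.ncard_le_ncard hsub (Set.toFinite _)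
    rwa [Set.ncard_insert_of_notMem (by simp [hb, hab.symm]), Set.ncard_insert_of_notMem ha] at this

/-- Once the colored vertices outnumber twice the initial ones, this can be kept until all vertices
are colored. -/
lemma two_mul_forcingNumber_lt (hconn : G.Connected) (hclaw : G.IsClawFree)
    (hcubic : G.IsRegularOfDegree 3) (S : Finset V)
    (hrich : G.IsPathRich (G.forcingClosure (S : Set V)))
    (hlt : 2 * S.card < (G.forcingClosure (S : Set V)).ncard) :
    2 * G.forcingNumber < Fintype.card V := by
  classical
  induction hm : Fintype.card V - (G.forcingClosure (S : Set V)).ncard using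
    Nat.strong_induction_on generalizing S with | _ m ih
  by_cases huniv : G.forcingClosure (S : Set V) = Set.univ
  · have h1 := forcingNumber_le huniv
    rw [huniv, Set.ncard_univ, Nat.card_eq_fintype_card] at hlt
    omega
  have hne : (G.forcingClosure (S : Set V)).Nonempty := by
    rw [← Set.ncard_pos (Set.toFinite _)]
    omega
  obtain ⟨v, hv, a, ha, hva⟩ := hconn.exists_adj_mem_notMem hne huniv
  have hgrow := (isStalled_forcingClosure (S : Set V)).ncard_add_two_le hclaw hcubic hrich hv ha hva
  have hrich' := IsPathRich.forcingClosure hcubic (hrich.insert hv ha hva)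
  rw [forcingClosure_insert_forcingClosure, ← Finset.coe_insert] at hgrow hrich'
  have hcard := Finset.card_insert_le a S
  have hbound : (G.forcingClosure ((insert a S : Finset V) : Set V)).ncard ≤ Fintype.card V := by
    rw [← Nat.card_eq_fintype_card]
    exact Set.ncard_le_card _
  -- Twice the cost rises by at most 2, the closure by at least 2.
  exact ih _ (by omega) (insert a S) hrich' (by omega) rfl

/-! ### Reaching a positive excess from a triangle. -/

/-- A stalled set containing a triangle two of whose vertices have a common neighbor outside the
triangle has at least six vertices. -/
lemma IsStalled.six_le_ncard_of_diamond (hcubic : G.IsRegularOfDegree 3) {C : Set V}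
    (hC : G.IsStalled C) {x y z d z' : V} (hx : x ∈ C) (hy : y ∈ C) (hz : z ∈ C) (hd : d ∈ C)
    (hz'C : z' ∈ C) (hxy : G.Adj x y) (hxz : G.Adj x z) (hyz : G.Adj y z)
    (hxd : G.Adj x d) (hyd : G.Adj y d) (hzz' : G.Adj z z') (hzd : d ≠ z) (hz'x : z' ≠ x)
    (hz'y : z' ≠ y) (hdz' : d ≠ z') : 6 ≤ C.ncard := by
  classical
  have hsix (T : Finset V) (hT : (T : Set V) ⊆ C) (hcard : T.card = 6) : 6 ≤ C.ncard := by
    rw [← hcard, ← Set.ncard_coe_finset]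
    exact Set.ncard_le_ncard hT (Set.toFinite _)
  have hxN {s : V} : G.Adj x s → s = y ∨ s = z ∨ s = d :=
    hcubic.eq_or_eq_or_eq hxy hxz hxd hyz.ne hyd.ne hzd.symm
  have hyN {s : V} : G.Adj y s → s = x ∨ s = z ∨ s = d :=
    hcubic.eq_or_eq_or_eq hxy.symm hyz hyd hxz.ne hxd.ne hzd.symm
  have hzN {s : V} : G.Adj z s → s = x ∨ s = y ∨ s = z' :=
    hcubic.eq_or_eq_or_eq hxz.symm hyz.symm hzz' hxy.ne hz'x.symm hz'y.symm
  obtain ⟨r, hdr, hrx, hry, -⟩ := hcubic.exists_third hxd.symm hyd.symm hxy.ne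
  have hrC : r ∈ C := hC.mem_of_adj hcubic hd hx hy hxd.symm hyd.symm hxy.ne hdr
  have hrz : r ≠ z := by
    rintro rfl
    rcases hzN hdr.symm with h | h | h
    · exact hxd.ne h.symm
    · exact hyd.ne h.symm
    · exact hdz' h
  have := hxy.ne
  have := hxz.ne
  have := hyz.ne
  have := hxd.ne
  have := hyd.ne
  have := hzz'.ne
  have := hdr.ne
  by_cases hrz' : r = z'
  · subst hrz'
    obtain ⟨e, hre, hez, hed, -⟩ := hcubic.exists_third hzz'.symm hdr.symm hzd.symm
    have heC : e ∈ C := hC.mem_of_adj hcubic hrC hz hd hzz'.symm hdr.symm hzd.symm hre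
    have := hre.ne
    have hex : e ≠ x := by
      rintro rfl
      rcases hxN hre.symm with h | h | h <;> simp_all
    have hey : e ≠ y := by
      rintro rfl
      rcases hyN hre.symm with h | h | h <;> simp_all
    refine hsix {x, y, z, d, r, e} (by simp [Set.insert_subset_iff, *]) ?_
    grind
  · refine hsix {x, y, z, d, z', r} (by simp [Set.insert_subset_iff, *]) ?_
    grind

lemma IsStalled.six_le_ncard (hconn : G.Connected) (hcubic : G.IsRegularOfDegree 3)
    (hcard : 5 ≤ Fintype.card V) {C : Set V} (hC : G.IsStalled C) {x y z : V} (hx : x ∈ C)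
    (hy : y ∈ C) (hz : z ∈ C) (hxy : G.Adj x y) (hxz : G.Adj x z) (hyz : G.Adj y z) :
    6 ≤ C.ncard := by
  classical
  obtain ⟨x', hxx', hx'y, hx'z, hxN⟩ := hcubic.exists_third hxy hxz hyz.ne
  obtain ⟨y', hyy', hy'x, hy'z, hyN⟩ := hcubic.exists_third hxy.symm hyz hxz.ne
  obtain ⟨z', hzz', hz'x, hz'y, hzN⟩ := hcubic.exists_third hxz.symm hyz.symm hxy.ne
  have hx'C : x' ∈ C := hC.mem_of_adj hcubic hx hy hz hxy hxz hyz.ne hxx'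
  have hy'C : y' ∈ C := hC.mem_of_adj hcubic hy hx hz hxy.symm hyz hxz.ne hyy'
  have hz'C : z' ∈ C := hC.mem_of_adj hcubic hz hx hy hxz.symm hyz.symm hxy.ne hzz'
  by_cases h1 : x' = y'
  · subst h1
    -- If all three outer neighbors coincide, the component is `K_4`, against order at least 5 and
    -- connectedness.
    by_cases h2 : x' = z'
    · subst h2
      have hN {s : V} : G.Adj x' s → s = x ∨ s = y ∨ s = z :=
        hcubic.eq_or_eq_or_eq hxx'.symm hyy'.symm hzz'.symm hxy.ne hxz.ne hyz.ne
      have huniv : (({x, y, z, x'} : Finset V) : Set V) = Set.univ := by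
        by_contra hne
        obtain ⟨v, hv, a, ha, hva⟩ := hconn.exists_adj_mem_notMem ⟨x, by simp⟩ hne
        simp only [Finset.coe_insert, Finset.coe_singleton, Set.mem_insert_iff,
          Set.mem_singleton_iff, not_or] at hv ha
        rcases hv with rfl | rfl | rfl | rfl
        · have := hxN a hva
          tauto
        · have := hyN a hva
          tauto
        · have := hzN a hva
          tauto
        · have := hN hva
          tauto
      have hle : ({x, y, z, x'} : Finset V).card ≤ 4 := Finset.card_le_four
      rw [Finset.coe_eq_univ.1 huniv, Finset.card_univ] at hle
      omega
    · exact hC.six_le_ncard_of_diamond hcubic hx hy hz hx'C hz'C hxy hxz hyz hxx' hyy' hzz' hx'z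
        hz'x hz'y h2
  by_cases h2 : x' = z'
  · subst h2
    exact hC.six_le_ncard_of_diamond hcubic hx hz hy hx'C hy'C hxz hxy hyz.symm hxx' hzz' hyy' hx'y
        hy'x hy'z h1
  by_cases h3 : y' = z'
  · subst h3
    exact hC.six_le_ncard_of_diamond hcubic hy hz hx hy'C hx'C hyz hxy.symm hxz.symm hyy' hzz' hxx'
      hy'x hx'y hx'z (Ne.symm h1)
  have hsub : (({x, y, z, x', y', z'} : Finset V) : Set V) ⊆ C := by
    simp [Set.insert_subset_iff, *]
  have hsix : ({x, y, z, x', y', z'} : Finset V).card = 6 := by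
    have := hxy.ne
    have := hxz.ne
    have := hyz.ne
    have := hxx'.ne
    have := hyy'.ne
    have := hzz'.ne
    grind
  rw [← hsix, ← Set.ncard_coe_finset]
  exact Set.ncard_le_ncard hsub (Set.toFinite _)

lemma IsClawFree.exists_triangle [Nonempty V] (hclaw : G.IsClawFree)
    (hcubic : G.IsRegularOfDegree 3) : ∃ x y z, G.Adj x y ∧ G.Adj x z ∧ G.Adj y z := by
  obtain ⟨v⟩ := ‹Nonempty V›
  obtain ⟨x, y, z, hx, hy, hz, hxy, hxz, hyz⟩ := hcubic.exists_three v
  rcases hclaw.adj_or_adj_or_adj hx hy hz hxy hxz hyz with h | h | h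
  · exact ⟨v, x, y, hx, hy, h⟩
  · exact ⟨v, x, z, hx, hz, h⟩
  · exact ⟨v, y, z, hy, hz, h⟩

/-- Starting from a triangle, at most two further vertices are needed before the colored vertices
outnumber twice the initial ones. -/
lemma exists_two_mul_card_lt_ncard_forcingClosure (hconn : G.Connected) (hclaw : G.IsClawFree)
    (hcubic : G.IsRegularOfDegree 3) (hcard : 10 ≤ Fintype.card V) :
    ∃ S : Finset V, G.IsPathRich (G.forcingClosure (S : Set V)) ∧
      2 * S.card < (G.forcingClosure (S : Set V)).ncard := by
  classical
  have hnonempty := hconn.nonempty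
  obtain ⟨x, y, z, hxy, hxz, hyz⟩ := hclaw.exists_triangle hcubic
  by_contra! hcon
  have hne_univ {C : Set V} (h : C.ncard < 10) : C ≠ Set.univ := by
    rintro rfl
    rw [Set.ncard_univ, Nat.card_eq_fintype_card] at h
    omega
  have hrich₀ : G.IsPathRich (G.forcingClosure (({x, y, z} : Finset V) : Set V)) := by
    refine IsPathRich.forcingClosure hcubic fun v hv => ?_
    simp only [Finset.coe_insert, Finset.coe_singleton, Set.mem_insert_iff,
      Set.mem_singleton_iff] at hv
    rcases hv with rfl | rfl | rfl
    · exact ⟨y, by simp, z, by simp, hxy, hyz, hxz.ne'⟩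
    · exact ⟨x, by simp, z, by simp, hxy.symm, hxz, hyz.ne'⟩
    · exact ⟨x, by simp, y, by simp, hxz.symm, hxy, hyz.ne⟩
  have hle₀ := hcon _ hrich₀
  have hsub₀ := subset_forcingClosure (G := G) (({x, y, z} : Finset V) : Set V)
  have hst₀ := isStalled_forcingClosure (G := G) (({x, y, z} : Finset V) : Set V)
  have hins₀ (a : V) := forcingClosure_insert_forcingClosure (G := G) a
    (({x, y, z} : Finset V) : Set V)
  have hcard₀ : ({x, y, z} : Finset V).card ≤ 3 := Finset.card_le_three
  generalize hS₀ : ({x, y, z} : Finset V) = S₀ at *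
  set C₀ := G.forcingClosure (S₀ : Set V)
  have hx : x ∈ C₀ := hsub₀ (by simp [← hS₀])
  have hy : y ∈ C₀ := hsub₀ (by simp [← hS₀])
  have hz : z ∈ C₀ := hsub₀ (by simp [← hS₀])
  have hsix := hst₀.six_le_ncard hconn hcubic (by omega) hx hy hz hxy hxz hyz
  obtain ⟨v, hv, a, ha, hva⟩ := hconn.exists_adj_mem_notMem ⟨x, hx⟩ (hne_univ (C := C₀) (by omega))
  have hst₁ := isStalled_forcingClosure (G := G) (insert a C₀)
  have hrich₁ := IsPathRich.forcingClosure hcubic (hrich₀.insert hv ha hva)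
  have hgrow₁ := hst₀.growth hclaw hcubic hrich₀ hv ha hva
  rw [hins₀, ← Finset.coe_insert] at hst₁ hrich₁ hgrow₁
  have hle₁ := hcon _ hrich₁
  have hins₁ (c : V) := forcingClosure_insert_forcingClosure (G := G) c
    ((insert a S₀ : Finset V) : Set V)
  have hcard₁ := Finset.card_insert_le a S₀
  set S₁ := insert a S₀
  set C₁ := G.forcingClosure (S₁ : Set V)
  rcases hgrow₁ with h | ⟨b, hb, w, hw, hab, hvw, hwa, hsub₁, hint⟩
  -- Four new vertices would give at least 10 colored for a cost of at most 4.
  · omega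
  have hC₀C₁ : C₀ ⊆ C₁ := fun t ht => hsub₁ (Or.inr (Or.inr ht))
  obtain ⟨p, hp, c, hc, hpc⟩ :=
    hconn.exists_adj_mem_notMem ⟨x, hC₀C₁ hx⟩ (hne_univ (C := C₁) (by omega))
  have hrich₂ := IsPathRich.forcingClosure hcubic (hrich₁.insert hp hc hpc)
  have hgrow₂ := hst₁.growth hclaw hcubic hrich₁ hp hc hpc
  rw [hins₁, ← Finset.coe_insert] at hrich₂ hgrow₂
  have hle₂ := hcon _ hrich₂
  have hcard₂ := Finset.card_insert_le c S₁
  have height : C₀.ncard + 2 ≤ C₁.ncard := by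
    have := Set.ncard_le_ncard hsub₁ (Set.toFinite _)
    rwa [Set.ncard_insert_of_notMem (by simp [hb, hab.symm]), Set.ncard_insert_of_notMem ha] at this
  rcases hgrow₂ with h | ⟨-, -, q, hq, -, hpq, hqc, -, -⟩
  -- Here at least 8 + 4 vertices would be colored for a cost of at most 5.
  · omega
  have htri {t : V} (ht : t = x ∨ t = y ∨ t = z) {s : V} (hs : G.Adj t s) : s ∈ C₀ := by
    rcases ht with rfl | rfl | rfl
    · exact hst₀.mem_of_adj hcubic hx hy hz hxy hxz hyz.ne hs
    · exact hst₀.mem_of_adj hcubic hy hx hz hxy.symm hyz hxz.ne hs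
    · exact hst₀.mem_of_adj hcubic hz hx hy hxz.symm hyz.symm hxy.ne hs
  have hopen₀ {t : V} (h : G.Adj t a) : t ≠ x ∧ t ≠ y ∧ t ≠ z := by
    by_contra hcon
    exact ha (htri (by tauto) h)
  -- The triangle and the first diamond have all their neighbors in `C₁`, so `p` and `q`, both
  -- adjacent to the uncolored `c`, lie outside them.
  have hopen₁ {t : V} (h : G.Adj t c) :
      t ≠ x ∧ t ≠ y ∧ t ≠ z ∧ t ≠ v ∧ t ≠ w ∧ t ≠ a ∧ t ≠ b := by
    refine ⟨?_, ?_, ?_, ?_⟩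
    · exact fun ht => hc (hC₀C₁ (htri (Or.inl ht) h))
    · exact fun ht => hc (hC₀C₁ (htri (Or.inr (Or.inl ht)) h))
    · exact fun ht => hc (hC₀C₁ (htri (Or.inr (Or.inr ht)) h))
    · by_contra hcon
      exact hc (hint t (by tauto) c h)
  have hsub : (({x, y, z, v, w, a, b, p, q} : Finset V) : Set V) ⊆ C₁ := by
    have haC : a ∈ C₁ := hsub₁ (by simp)
    have hbC : b ∈ C₁ := hsub₁ (by simp)
    have := hC₀C₁ hx
    have := hC₀C₁ hy
    have := hC₀C₁ hz
    have := hC₀C₁ hv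
    have := hC₀C₁ hw
    simp only [Finset.coe_insert, Finset.coe_singleton, Set.insert_subset_iff,
      Set.singleton_subset_iff]
    tauto
  have hnine : ({x, y, z, v, w, a, b, p, q} : Finset V).card = 9 := by
    have hne {s t : V} (hs : s ∈ C₀) (ht : t ∉ C₀) : s ≠ t := fun h => ht (h ▸ hs)
    have hvt := hopen₀ hva
    have hwt := hopen₀ hwa
    have hpt := hopen₁ hpc
    have hqt := hopen₁ hqc
    have hxy' := hxy.ne
    have hxz' := hxz.ne
    have hyz' := hyz.ne
    have hxa' := hne hx ha
    have hya' := hne hy ha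
    have hza' := hne hz ha
    have hva' := hne hv ha
    have hwa' := hne hw ha
    have hxb' := hne hx hb
    have hyb' := hne hy hb
    have hzb' := hne hz hb
    have hvb' := hne hv hb
    have hwb' := hne hw hb
    clear * - hvt hwt hpt hqt hab hvw hpq hxa' hya' hza' hva' hwa' hxb' hyb' hzb'
      hvb' hwb' hxy' hxz' hyz'
    repeat rw [Finset.card_insert_of_notMem
      (by simp only [Finset.mem_insert, Finset.mem_singleton]; grind)]
    rfl
  have := Set.ncard_le_ncard hsub (Set.toFinite _)
  rw [Set.ncard_coe_finset, hnine] at this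
  omega

end Cubic

end SimpleGraph

theorem corollary1 {V : Type*} [Fintype V] (G : SimpleGraph V) [DecidableRel G.Adj] (n : ℕ)
    (hconn : G.Connected) (hclaw : G.IsClawFree) (hcubic : G.IsRegularOfDegree 3)
    (hn : Fintype.card V = n) (hn10 : 10 ≤ n) :
    (G.forcingNumber : ℝ) < (n : ℝ) / 2 := by
  subst hn
  obtain ⟨S, hrich, hlt⟩ :=
    SimpleGraph.exists_two_mul_card_lt_ncard_forcingClosure hconn hclaw hcubic hn10
  have h : ((2 * G.forcingNumber : ℕ) : ℝ) < (Fintype.card V : ℕ) :=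
    Nat.cast_lt.2 (SimpleGraph.two_mul_forcingNumber_lt hconn hclaw hcubic S hrich hlt)
  push_cast at h
  linarith
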